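/- Let $T$ be a tree (a connected nonempty graph without cycles). An automorphism of $T$ is called \emph{elliptic} if it fixes a vertex or inverts an edge, that is, interchanges the two endpoints of some edge. A \emph{ray} is a semi-infinite geodesic in $T$; two rays belong to the same \emph{end} if their intersection is a ray, and $\mathrm{Aut}(T)$ acts on the set of ends so obtained. Equip $\mathrm{Aut}(T)$ with the topology of pointwise convergence on the (discrete) set of vertices. A \emph{semigroup} of automorphisms is a nonempty subset of $\mathrm{Aut}(T)$ closed under composition. Let $\mathcal S$ be a semigroup of automorphisms of $T$ all of whose elements are elliptic. Then: (1) at least one of the following holds: there is a vertex of $T$ fixed by every element of $\mathcal S$; or $\mathcal S$ inverts an edge, i.e. there is an edge of $T$ that is preserved by every element of $\mathcal S$ and whose endpoints are interchanged by some element of $\mathcal S$; or there is an end of $T$ fixed by every element of $\mathcal S$. (2) If moreover $T$ is locally finite and $\mathcal S$ is closed in $\mathrm{Aut}(T)$, then $\mathcal S$ is a subgroup of $\mathrm{Aut}(T)$, and if it does not fix an end of $T$, then it is compact. -/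

import Mathlib

namespace TreeAut

variable {V : Type*} {T : SimpleGraph V}

/-- The automorphism group `T ≃g T` (multiplication is composition) carries the topology of
pointwise convergence on the vertices, where the vertex set is discrete. For automorphisms this
is also the compact-open topology: the pointwise stabilizers of finite sets of vertices
form a basis of neighbourhoods of the identity. -/
instance autTopology (T : SimpleGraph V) : TopologicalSpace (T ≃g T) :=
  TopologicalSpace.induced (fun g : T ≃g T => (g : V → V))
    (@Pi.topologicalSpace V (fun _ => V) (fun _ => ⊥))

/-- An automorphism is elliptic if it fixes a vertex or inverts an edge. -/
def IsElliptic (g : T ≃g T) : Prop :=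
  (∃ v, g v = v) ∨ ∃ v w, T.Adj v w ∧ g v = w ∧ g w = v

/-- A ray: (the vertex set of) a semi-infinite geodesic. -/
def IsRay (T : SimpleGraph V) (R : Set V) : Prop :=
  ∃ r : ℕ → V, (∀ i j : ℕ, T.dist (r i) (r (i + j)) = j) ∧ Set.range r = R

/-- Two rays belong to the same end if their intersection is a ray. -/
def SameEnd (T : SimpleGraph V) (R R' : Set V) : Prop :=
  IsRay T R ∧ IsRay T R' ∧ IsRay T (R ∩ R')

/-- An end of a tree: the class of all rays that belong to the same end as a given ray. -/
def IsEnd (T : SimpleGraph V) (ω : Set (Set V)) : Prop :=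
  ∃ R, IsRay T R ∧ ω = {R' | SameEnd T R R'}

/-- The image of a set of rays under an automorphism. -/
def mapEnd (g : T ≃g T) (ω : Set (Set V)) : Set (Set V) :=
  (fun R : Set V => g '' R) '' ω

/-- All elements of `S` fix one common vertex. -/
def FixesVertex (S : Set (T ≃g T)) : Prop :=
  ∃ v, ∀ g ∈ S, g v = v

/-- `S` inverts an edge: all elements of `S` preserve one common edge `{v, w}`, and some element
of `S` interchanges its two endpoints. -/
def InvertsEdge (S : Set (T ≃g T)) : Prop :=
  ∃ v w, T.Adj v w ∧
    (∀ g ∈ S, (g v = v ∧ g w = w) ∨ (g v = w ∧ g w = v)) ∧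
    ∃ g ∈ S, g v = w ∧ g w = v

/-- All elements of `S` fix one common end of the tree. -/
def FixesEnd (S : Set (T ≃g T)) : Prop :=
  ∃ ω, IsEnd T ω ∧ ∀ g ∈ S, mapEnd g ω = ω

end TreeAut

/-! Displacements have a parity: even at every vertex if a vertex is fixed, odd if an edge is
inverted. If some `g` in `S` inverts an edge, comparing it with products `g * k` forces every
element to preserve that edge (`invertsEdge_of_mem`). Otherwise every element fixes a vertex, and
since products do too, any two elements have a common fixed vertex (`exists_common_fixed`). A
Helly-type argument on these fixed subtrees (`fixesVertex_or_fixesEnd`) projects a base vertex to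
each: the projections are bounded, and the farthest is fixed by all, or they trace a ray whose end
is fixed.

In the locally finite case, powers of an elliptic `g` have finite orbits, so `g ^ (n! - 1)` tends to
`g⁻¹` and closedness yields inverses. Without a fixed end some vertex moves by at most 1, and
bounded displacement gives compactness. -/

namespace SimpleGraph

variable {V : Type*} {T : SimpleGraph V}

/-! ### Metric geometry of trees -/

theorem Connected.exists_adj_dist_add_one (hT : T.Connected) {u v : V} (h : u ≠ v) :
    ∃ w, T.Adj u w ∧ T.dist w v + 1 = T.dist u v := by
  obtain ⟨p, hp⟩ := hT.exists_walk_length_eq_dist u v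
  cases p with
  | nil => exact absurd rfl h
  | @cons _ w _ hadj q =>
    refine ⟨w, hadj, ?_⟩
    have h1 := dist_le q
    have h2 := hT.dist_triangle (u := u) (v := w) (w := v)
    have h3 := dist_eq_one_iff_adj.mpr hadj
    rw [Walk.length_cons] at hp
    omega

theorem Connected.exists_dist_eq_dist_eq (hT : T.Connected) (u v : V) {n : ℕ}
    (hn : n ≤ T.dist u v) : ∃ m, T.dist u m = n ∧ T.dist u m + T.dist m v = T.dist u v := by
  induction n generalizing u with
  | zero => exact ⟨u, by simp⟩
  | succ n ih =>
    have huv : u ≠ v := by rintro rfl; simp at hn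
    obtain ⟨w, hw, hd⟩ := hT.exists_adj_dist_add_one huv
    obtain ⟨m, hm, hm'⟩ := ih w (by omega)
    have h1 := hT.dist_triangle (u := u) (v := w) (w := m)
    have h2 := hT.dist_triangle (u := u) (v := m) (w := v)
    have h3 := dist_eq_one_iff_adj.mpr hw
    exact ⟨m, by omega, by omega⟩

namespace IsTree

theorem eq_of_adj_of_dist_add_one (hT : T.IsTree) {x a b v : V} (ha : T.Adj x a)
    (hb : T.Adj x b) (hav : T.dist a v + 1 = T.dist x v) (hbv : T.dist b v + 1 = T.dist x v) :
    a = b := by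
  have key : ∀ c (hc : T.Adj x c), T.dist c v + 1 = T.dist x v →
      ∃ p : T.Walk c v, (Walk.cons hc p).IsPath := by
    intro c hc hcv
    obtain ⟨p, hp⟩ := hT.connected.exists_walk_length_eq_dist c v
    exact ⟨p, Walk.isPath_of_length_eq_dist _ (by rw [Walk.length_cons]; omega)⟩
  obtain ⟨p, hp⟩ := key a ha hav
  obtain ⟨q, hq⟩ := key b hb hbv
  have := (hT.existsUnique_path x v).unique hp hq
  simpa using congrArg Walk.snd this

/-- Bipartiteness in metric form, the source of all parity arguments. -/
theorem even_dist_add_dist_add_dist (hT : T.IsTree) (x y z : V) :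
    Even (T.dist x y + T.dist y z + T.dist x z) := by
  induction h : T.dist y z generalizing y with
  | zero =>
    obtain rfl := hT.connected.dist_eq_zero_iff.mp h
    exact ⟨T.dist x y, by omega⟩
  | succ n ih =>
    have hyz : y ≠ z := by rintro rfl; simp at h
    obtain ⟨w, hw, hd⟩ := hT.connected.exists_adj_dist_add_one hyz
    have h1 := ih w (by omega)
    have h2 := hT.dist_eq_dist_add_one_of_adj x hw
    rw [Nat.even_iff] at *
    omega

/-- If the first step from `x` towards `y` leads away from `v`, then `x` lies between `y`
and `v`. -/
theorem dist_eq_add_of_adj (hT : T.IsTree) {x x' y v : V} (hx : T.Adj x x')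
    (hy : T.dist x' y + 1 = T.dist x y) (hv : T.dist x' v = T.dist x v + 1) :
    T.dist y v = T.dist y x + T.dist x v := by
  induction h : T.dist x' y generalizing y with
  | zero =>
    obtain rfl := hT.connected.dist_eq_zero_iff.mp h
    rw [dist_comm (u := x') (v := x)]
    omega
  | succ n ih =>
    have hne : y ≠ x' := by rintro rfl; simp at h
    obtain ⟨z, hz, hd⟩ := hT.connected.exists_adj_dist_add_one hne
    have c1 := dist_comm (G := T) (u := z) (v := x')
    have c2 := dist_comm (G := T) (u := y) (v := x')
    have c3 := dist_comm (G := T) (u := z) (v := x)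
    have c4 := dist_comm (G := T) (u := y) (v := x)
    have c5 := dist_comm (G := T) (u := x) (v := x')
    have t1 := hT.connected.dist_triangle (u := x) (v := x') (w := z)
    have t2 := hT.connected.dist_triangle (u := x) (v := z) (w := y)
    have a1 := dist_eq_one_iff_adj.mpr hx
    have a2 := dist_eq_one_iff_adj.mpr hz.symm
    have hzx : T.dist x' z + 1 = T.dist x z := by omega
    have hzv := ih hzx (by omega)
    have : ∃ w, T.Adj z w ∧ T.dist w v + 1 = T.dist z v ∧ T.dist w y ≠ 0 := by
      by_cases hzx' : z = x'
      · subst hzx'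
        exact ⟨x, hx.symm, by omega, by omega⟩
      · obtain ⟨w, hw, hwd⟩ := hT.connected.exists_adj_dist_add_one hzx'
        have c6 := dist_comm (G := T) (u := w) (v := x')
        have c7 := dist_comm (G := T) (u := w) (v := x)
        have c8 := dist_comm (G := T) (u := w) (v := y)
        have t3 := hT.connected.dist_triangle (u := x) (v := x') (w := w)
        have t4 := hT.connected.dist_triangle (u := w) (v := x) (w := v)
        have t5 := hT.connected.dist_triangle (u := x') (v := w) (w := y)
        have t6 := hT.connected.dist_triangle (u := z) (v := w) (w := v)
        have a3 := dist_eq_one_iff_adj.mpr hw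
        exact ⟨w, hw, by omega, by omega⟩
    -- If `y` were closer to `v` than `z`, then `y` and `w` would be two distinct first steps from
    -- `z` towards `v`.
    obtain ⟨w, hw, hwv, hwy⟩ := this
    rcases hT.dist_eq_dist_add_one_of_adj v hz with h1 | h1
    · rw [dist_comm (u := v), dist_comm (u := v)] at h1
      omega
    · rw [dist_comm (u := v), dist_comm (u := v)] at h1
      exact absurd (hT.connected.dist_eq_zero_iff.mpr
        (hT.eq_of_adj_of_dist_add_one hw hz.symm hwv h1.symm)) hwy

/-- Trees are `0`-hyperbolic: the four-point condition. -/
theorem dist_add_dist_le_max (hT : T.IsTree) (x y u v : V) :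
    T.dist x y + T.dist u v ≤
      max (T.dist x u + T.dist y v) (T.dist x v + T.dist y u) := by
  induction h : T.dist x y generalizing x with
  | zero =>
    obtain rfl := hT.connected.dist_eq_zero_iff.mp h
    have := hT.connected.dist_triangle (u := u) (v := x) (w := v)
    rw [dist_comm (u := u) (v := x)] at this
    omega
  | succ n ih =>
    have hxy : x ≠ y := by rintro rfl; simp at h
    obtain ⟨w, hw, hd⟩ := hT.connected.exists_adj_dist_add_one hxy
    have h0 := ih w (by omega)
    have hu := hT.dist_eq_dist_add_one_of_adj u hw
    have hv := hT.dist_eq_dist_add_one_of_adj v hw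
    have t := hT.connected.dist_triangle (u := u) (v := x) (w := v)
    have c1 := dist_comm (G := T) (u := u) (v := x)
    have c2 := dist_comm (G := T) (u := v) (v := x)
    have c3 := dist_comm (G := T) (u := u) (v := w)
    have c4 := dist_comm (G := T) (u := v) (v := w)
    have c5 := dist_comm (G := T) (u := x) (v := y)
    -- When the step leads away from `u` or `v`, `x` lies between `y` and that vertex, and the
    -- triangle inequality suffices.
    rcases hu with hu | hu <;> rcases hv with hv | hv
    · omega
    · have := hT.dist_eq_add_of_adj hw hd (v := v) (by omega)
      omega
    · have := hT.dist_eq_add_of_adj hw hd (v := u) (by omega)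
      omega
    · have := hT.dist_eq_add_of_adj hw hd (v := v) (by omega)
      omega

/-- Points on a geodesic are as far apart as their distances from its origin suggest. -/
theorem dist_add_dist_of_between (hT : T.IsTree) {u v p q : V}
    (hp : T.dist u p + T.dist p v = T.dist u v) (hq : T.dist u q + T.dist q v = T.dist u v)
    (h : T.dist u p ≤ T.dist u q) : T.dist u p + T.dist p q = T.dist u q := by
  have h4 := hT.dist_add_dist_le_max p q u v
  have t := hT.connected.dist_triangle (u := u) (v := p) (w := q)
  rw [dist_comm (u := p) (v := u), dist_comm (u := q) (v := u)] at h4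
  omega

theorem eq_of_between (hT : T.IsTree) {u v p q : V}
    (hp : T.dist u p + T.dist p v = T.dist u v) (hq : T.dist u q + T.dist q v = T.dist u v)
    (h : T.dist u p = T.dist u q) : p = q := by
  have := hT.dist_add_dist_of_between hp hq h.le
  exact hT.connected.dist_eq_zero_iff.mp (by omega)

theorem exists_median (hT : T.IsTree) (x y z : V) :
    ∃ m, T.dist x m + T.dist m y = T.dist x y ∧ T.dist x m + T.dist m z = T.dist x z ∧
      T.dist y m + T.dist m z = T.dist y z := by
  obtain ⟨k, hk⟩ := hT.even_dist_add_dist_add_dist x y z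
  have t1 := hT.connected.dist_triangle (u := x) (v := y) (w := z)
  have t2 := hT.connected.dist_triangle (u := x) (v := z) (w := y)
  have t3 := hT.connected.dist_triangle (u := y) (v := x) (w := z)
  have c1 := dist_comm (G := T) (u := x) (v := y)
  have c2 := dist_comm (G := T) (u := y) (v := z)
  -- `k` is half the perimeter, so `k - T.dist y z` is the Gromov product of `y` and `z` at `x`.
  obtain ⟨m, hm, hm'⟩ := hT.connected.exists_dist_eq_dist_eq x y (n := k - T.dist y z) (by omega)
  have h4 := hT.dist_add_dist_le_max x y m z
  have t4 := hT.connected.dist_triangle (u := x) (v := m) (w := z)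
  have t5 := hT.connected.dist_triangle (u := y) (v := m) (w := z)
  have c3 := dist_comm (G := T) (u := y) (v := m)
  exact ⟨m, by omega, by omega, by omega⟩

end IsTree

theorem dist_iso_apply (g : T ≃g T) (u v : V) : T.dist (g u) (g v) = T.dist u v := by
  have key : ∀ (f : T ≃g T) (a b : V), T.edist (f a) (f b) ≤ T.edist a b := by
    intro f a b
    refine le_iInf fun p => ?_
    simpa using edist_le (p.map f.toHom)
  have h1 := key g u v
  have h2 := key g.symm (g u) (g v)
  simp only [RelIso.symm_apply_apply] at h2
  simp only [dist, le_antisymm h1 h2]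

end SimpleGraph

/-! ### Parity of displacement and products of elliptic automorphisms -/

namespace TreeAut

open SimpleGraph

variable {V : Type*} {T : SimpleGraph V}

theorem even_dist_apply_of_fixed (hT : T.IsTree) {g : T ≃g T} {v : V} (hv : g v = v) (x : V) :
    Even (T.dist x (g x)) := by
  have h1 := hT.even_dist_add_dist_add_dist v x (g x)
  have h2 := dist_iso_apply g v x
  rw [hv] at h2
  rw [Nat.even_iff] at *
  omega

theorem odd_dist_apply_of_inverts (hT : T.IsTree) {g : T ≃g T} {a b : V} (hab : T.Adj a b)
    (ha : g a = b) (x : V) : Odd (T.dist x (g x)) := by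
  have h1 := hT.even_dist_add_dist_add_dist x a b
  have h2 := hT.even_dist_add_dist_add_dist x b (g x)
  have h3 := dist_iso_apply g a x
  have h4 := dist_eq_one_iff_adj.mpr hab
  rw [ha, dist_comm (u := a)] at h3
  rw [Nat.odd_iff]
  rw [Nat.even_iff] at *
  omega

theorem IsElliptic.exists_fixed_of_even (hT : T.IsTree) {g : T ≃g T} (hg : IsElliptic g) {x : V}
    (hx : Even (T.dist x (g x))) : ∃ v, g v = v := by
  rcases hg with h | ⟨a, b, hab, ha, -⟩
  · exact h
  · exact absurd hx (Nat.not_even_iff_odd.mpr (odd_dist_apply_of_inverts hT hab ha x))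

theorem IsElliptic.exists_inverts_of_odd (hT : T.IsTree) {g : T ≃g T} (hg : IsElliptic g) {x : V}
    (hx : Odd (T.dist x (g x))) : ∃ a b, T.Adj a b ∧ g a = b ∧ g b = a := by
  rcases hg with ⟨v, hv⟩ | h
  · exact absurd (even_dist_apply_of_fixed hT hv x) (Nat.not_even_iff_odd.mpr hx)
  · exact h

theorem even_dist_mul_apply (hT : T.IsTree) (g h : T ≃g T) (x : V) :
    Even (T.dist x (h x) + T.dist (h x) (g (h x)) + T.dist x ((g * h) x)) :=
  hT.even_dist_add_dist_add_dist x (h x) (g (h x))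

/-- An automorphism with a fixed vertex fixes the midpoint of every geodesic from a vertex to
its image. -/
theorem apply_midpoint_eq (hT : T.IsTree) {g : T ≃g T} {v x m : V} (hv : g v = v)
    (hm : T.dist x m + T.dist m (g x) = T.dist x (g x)) (hm' : T.dist x m = T.dist m (g x)) :
    g m = m := by
  -- `x` and `g x` are equidistant from `v`, so this median is the midpoint `m`.
  obtain ⟨n, h1, h2, h3⟩ := hT.exists_median x (g x) v
  have e1 := dist_iso_apply g x v
  have e2 := dist_iso_apply g n x
  have e3 := dist_iso_apply g v n
  rw [hv] at e1 e3
  have c1 := dist_comm (G := T) (u := g x) (v := n)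
  have c2 := dist_comm (G := T) (u := g x) (v := v)
  have c3 := dist_comm (G := T) (u := x) (v := n)
  have c4 := dist_comm (G := T) (u := v) (v := n)
  obtain rfl : m = n := hT.eq_of_between hm h1 (by omega)
  exact hT.eq_of_between (u := v) (v := g x) (by omega) (by omega) e3

/-- `g` carries `h x` back to `x`, so both automorphisms fix the midpoint of the same geodesic. -/
theorem exists_common_fixed (hT : T.IsTree) {g h : T ≃g T} {v w x : V} (hv : g v = v)
    (hw : h w = w) (hx : (g * h) x = x) : ∃ m, g m = m ∧ h m = m := by
  change g (h x) = x at hx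
  obtain ⟨k, hk⟩ := even_dist_apply_of_fixed hT hw x
  obtain ⟨m, hm, hm'⟩ := hT.connected.exists_dist_eq_dist_eq x (h x) (n := k) (by omega)
  have c1 := dist_comm (G := T) (u := h x) (v := m)
  have c2 := dist_comm (G := T) (u := x) (v := m)
  have c3 := dist_comm (G := T) (u := x) (v := h x)
  refine ⟨m, apply_midpoint_eq hT (x := h x) hv ?_ ?_, apply_midpoint_eq hT hw hm' (by omega)⟩
  all_goals rw [hx]; omega

/-- An inverted edge is the middle edge of every geodesic from a vertex to its image. -/
theorem middle_edge_of_inverts (hT : T.IsTree) {g : T ≃g T} {a b : V} (hab : T.Adj a b)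
    (ha : g a = b) (hb : g b = a) {x : V} (hx : T.dist x b = T.dist x a + 1) :
    T.dist x (g x) = 2 * T.dist x a + 1 ∧ T.dist a (g x) = T.dist x a + 1 ∧
      T.dist b (g x) = T.dist x a := by
  have e1 := dist_iso_apply g a x
  have e2 := dist_iso_apply g b x
  rw [ha] at e1
  rw [hb] at e2
  have c1 := dist_comm (G := T) (u := x) (v := a)
  have c2 := dist_comm (G := T) (u := x) (v := b)
  have c3 := dist_comm (G := T) (u := g x) (v := a)
  have c4 := dist_comm (G := T) (u := g x) (v := b)
  have h1 := dist_eq_one_iff_adj.mpr hab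
  have h4 := hT.dist_add_dist_le_max x b (g x) a
  have h5 := hT.dist_add_dist_le_max x b a (g x)
  have t1 := hT.connected.dist_triangle (u := x) (v := a) (w := g x)
  have c5 := dist_comm (G := T) (u := a) (v := b)
  omega

/-- If the product of two edge inversions fixes a vertex, then they invert the same edge. -/
theorem inverts_same_of_mul_fixed (hT : T.IsTree) {g k : T ≃g T} {a b c d x : V}
    (hab : T.Adj a b) (ha : g a = b) (hb : g b = a) (hcd : T.Adj c d) (hc : k c = d)
    (hd : k d = c) (hx : (g * k) x = x) : (c = a ∧ d = b) ∨ (c = b ∧ d = a) := by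
  change g (k x) = x at hx
  wlog h1 : T.dist x d = T.dist x c + 1 generalizing c d
  · have := hT.dist_eq_dist_add_one_of_adj x hcd
    rcases this with h | h
    · rcases this hcd.symm hd hc h with h | h
      · exact Or.inr h.symm
      · exact Or.inl h.symm
    · exact absurd h h1
  wlog h2 : T.dist (k x) b = T.dist (k x) a + 1 generalizing a b
  · have := hT.dist_eq_dist_add_one_of_adj (k x) hab
    rcases this with h | h
    · exact (this hab.symm hb ha h).symm
    · exact absurd h h2
  -- Both edges are the middle edge of the geodesic between `x` and `k x`, traversed from opposite
  -- ends.
  obtain ⟨p1, p2, p3⟩ := middle_edge_of_inverts hT hcd hc hd h1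
  obtain ⟨q1, q2, q3⟩ := middle_edge_of_inverts hT hab ha hb h2
  rw [hx] at q1 q2 q3
  have c1 := dist_comm (G := T) (u := k x) (v := x)
  have c2 := dist_comm (G := T) (u := k x) (v := a)
  have c3 := dist_comm (G := T) (u := k x) (v := b)
  have c4 := dist_comm (G := T) (u := a) (v := x)
  have c5 := dist_comm (G := T) (u := b) (v := x)
  exact Or.inr ⟨hT.eq_of_between (u := x) (v := k x) (by omega) (by omega) (by omega),
    hT.eq_of_between (u := x) (v := k x) (by omega) (by omega) (by omega)⟩

theorem invertsEdge_of_mem (hT : T.IsTree) {S : Subsemigroup (T ≃g T)}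
    (hS : ∀ g ∈ S, IsElliptic g) {g : T ≃g T} (hg : g ∈ S) {a b : V} (hab : T.Adj a b)
    (ha : g a = b) (hb : g b = a) : InvertsEdge (S : Set (T ≃g T)) := by
  have key : ∀ k ∈ S, Odd (T.dist a (k a)) → k a = b ∧ k b = a := by
    intro k hk hodd
    obtain ⟨c, d, hcd, hc, hd⟩ := (hS k hk).exists_inverts_of_odd hT hodd
    have h1 := odd_dist_apply_of_inverts hT hab ha (k a)
    have h2 := even_dist_mul_apply hT g k a
    obtain ⟨x, hx⟩ := (hS _ (S.mul_mem hg hk)).exists_fixed_of_even hT (x := a) (by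
      rw [Nat.even_iff] at *
      rw [Nat.odd_iff] at *
      omega)
    rcases inverts_same_of_mul_fixed hT hab ha hb hcd hc hd hx with ⟨rfl, rfl⟩ | ⟨rfl, rfl⟩
    · exact ⟨hc, hd⟩
    · exact ⟨hd, hc⟩
  refine ⟨a, b, hab, fun h hh => ?_, g, hg, ha, hb⟩
  by_cases hodd : Odd (T.dist a (h a))
  · exact Or.inr (key h hh hodd)
  -- Here `g * h` is odd, hence swaps `a` and `b` as `g` does; cancel `g`.
  · have h1 := odd_dist_apply_of_inverts hT hab ha (h a)
    have h2 := even_dist_mul_apply hT g h a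
    obtain ⟨k1, k2⟩ := key _ (S.mul_mem hg hh) (by
      rw [Nat.even_iff] at *
      rw [Nat.odd_iff] at *
      omega)
    change g (h a) = b at k1
    change g (h b) = a at k2
    exact Or.inl ⟨g.injective (k1.trans ha.symm), g.injective (k2.trans hb.symm)⟩

/-! ### Rays and ends -/

/-- Fixed-point sets of automorphisms are geodesically convex. -/
theorem fixed_of_between (hT : T.IsTree) {g : T ≃g T} {u v m : V} (hu : g u = u) (hv : g v = v)
    (hm : T.dist u m + T.dist m v = T.dist u v) : g m = m := by
  have e1 := dist_iso_apply g u m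
  have e2 := dist_iso_apply g m v
  rw [hu] at e1
  rw [hv] at e2
  exact hT.eq_of_between (u := u) (v := v) (by omega) hm e1

theorem IsRay.infinite {R : Set V} (hR : IsRay T R) : R.Infinite := by
  obtain ⟨r, hr, rfl⟩ := hR
  refine Set.infinite_range_of_injective fun i j hij => ?_
  wlog h : i ≤ j generalizing i j
  · exact (this j i hij.symm (by omega)).symm
  have := hr i (j - i)
  rw [Nat.add_sub_cancel' h, hij, SimpleGraph.dist_self] at this
  omega

theorem IsRay.image {R : Set V} (hR : IsRay T R) (g : T ≃g T) : IsRay T (g '' R) := by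
  obtain ⟨r, hr, rfl⟩ := hR
  refine ⟨fun n => g (r n), fun i j => ?_, Set.range_comp g r⟩
  rw [dist_iso_apply, hr]

theorem IsRay.mem_of_between (hT : T.IsTree) {R : Set V} (hR : IsRay T R) {u v m : V}
    (hu : u ∈ R) (hv : v ∈ R) (hm : T.dist u m + T.dist m v = T.dist u v) : m ∈ R := by
  obtain ⟨r, hr, rfl⟩ := hR
  obtain ⟨i, rfl⟩ := hu
  obtain ⟨j, rfl⟩ := hv
  wlog h : i ≤ j generalizing i j
  · have c1 := SimpleGraph.dist_comm (G := T) (u := r i) (v := m)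
    have c2 := SimpleGraph.dist_comm (G := T) (u := r j) (v := m)
    have c3 := SimpleGraph.dist_comm (G := T) (u := r i) (v := r j)
    exact this j i (by omega) (by omega)
  obtain ⟨k, rfl⟩ := Nat.exists_eq_add_of_le h
  have h1 := hr i k
  refine ⟨i + T.dist (r i) m, ?_⟩
  have h2 := hr i (T.dist (r i) m)
  have h3 := hr (i + T.dist (r i) m) (k - T.dist (r i) m)
  rw [show i + T.dist (r i) m + (k - T.dist (r i) m) = i + k by omega] at h3
  exact hT.eq_of_between (by omega) hm h2

/-- By convexity, `r` never leaves `R'` between two visits, so the intersection is the tail of `r`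
from its first visit. -/
theorem IsRay.inter (hT : T.IsTree) {R R' : Set V} (hR : IsRay T R) (hR' : IsRay T R')
    (h : (R ∩ R').Infinite) : IsRay T (R ∩ R') := by
  classical
  obtain ⟨r, hr, rfl⟩ := hR
  have hinf : {n | r n ∈ R'}.Infinite := by
    refine fun hfin => h ((hfin.image r).subset ?_)
    rintro _ ⟨⟨n, rfl⟩, hn⟩
    exact ⟨n, hn, rfl⟩
  have hex : ∃ n, r n ∈ R' := hinf.nonempty
  have hmem : ∀ n, Nat.find hex ≤ n → r n ∈ R' := by
    intro n hn
    obtain ⟨k, hk, hnk⟩ := hinf.exists_gt n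
    refine hR'.mem_of_between hT (Nat.find_spec hex) hk ?_
    have h1 := hr (Nat.find hex) (n - Nat.find hex)
    have h2 := hr n (k - n)
    have h3 := hr (Nat.find hex) (k - Nat.find hex)
    rw [Nat.add_sub_cancel' (by omega)] at h1 h2 h3
    omega
  refine ⟨fun n => r (Nat.find hex + n), fun i j => by simp only [← add_assoc, hr], ?_⟩
  ext x
  constructor
  · rintro ⟨n, rfl⟩
    exact ⟨⟨_, rfl⟩, hmem _ (by omega)⟩
  · rintro ⟨⟨n, rfl⟩, hn⟩
    have := Nat.find_min' hex hn
    exact ⟨n - Nat.find hex, by simp only; rw [Nat.add_sub_cancel' this]⟩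

theorem SameEnd.image_of_fixed (hT : T.IsTree) {g : T ≃g T} {r : ℕ → V} {N : ℕ}
    (hN : ∀ n ≥ N, g (r n) = r n) {R' : Set V} (h : SameEnd T (Set.range r) R') :
    SameEnd T (Set.range r) (g '' R') := by
  obtain ⟨h1, h2, h3⟩ := h
  refine ⟨h1, h2.image g, h1.inter hT (h2.image g) fun hfin => h3.infinite ?_⟩
  refine (hfin.union ((Set.finite_lt_nat N).image r)).subset ?_
  rintro _ ⟨⟨n, rfl⟩, hn⟩
  by_cases hnN : n < N
  · exact Or.inr ⟨n, hnN, rfl⟩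
  · exact Or.inl ⟨⟨n, rfl⟩, r n, hn, hN n (by omega)⟩

theorem mapEnd_eq_of_fixed (hT : T.IsTree) {g : T ≃g T} {r : ℕ → V} {N : ℕ}
    (hN : ∀ n ≥ N, g (r n) = r n) :
    mapEnd g {R' | SameEnd T (Set.range r) R'} = {R' | SameEnd T (Set.range r) R'} := by
  ext R'
  constructor
  · rintro ⟨R, hR, rfl⟩
    exact SameEnd.image_of_fixed hT hN hR
  · intro hR'
    refine ⟨g.symm '' R', SameEnd.image_of_fixed hT (N := N) (fun n hn => ?_) hR', ?_⟩
    · rw [RelIso.symm_apply_eq, hN n hn]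
    · simp only [Set.image_image, RelIso.apply_symm_apply, Set.image_id']

/-- Take `p` to be a fixed vertex nearest to `v₀`; the median of `v₀`, `p`, `z` is fixed by
convexity, so minimality makes it `p`. -/
theorem exists_gate (hT : T.IsTree) (v₀ : V) {g : T ≃g T} (hg : ∃ v, g v = v) :
    ∃ p, g p = p ∧ ∀ z, g z = z → T.dist v₀ p + T.dist p z = T.dist v₀ z := by
  obtain ⟨_, ⟨p, hgp, rfl⟩, hmin⟩ := exists_minimal_of_wellFoundedLT
    (fun n => ∃ v, g v = v ∧ T.dist v₀ v = n) (hg.elim fun v hv => ⟨_, v, hv, rfl⟩)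
  refine ⟨p, hgp, fun z hz => ?_⟩
  obtain ⟨m, h1, h2, h3⟩ := hT.exists_median v₀ p z
  have hgm := fixed_of_between hT hgp hz h3
  have hle := hmin ⟨m, hgm, rfl⟩ (by omega)
  have : m = p := hT.connected.dist_eq_zero_iff.mp (by omega)
  rwa [this] at h2

theorem fixesVertex_or_fixesEnd (hT : T.IsTree) {S : Set (T ≃g T)}
    (hS : ∀ g ∈ S, ∀ h ∈ S, ∃ m, g m = m ∧ h m = m) : FixesVertex S ∨ FixesEnd S := by
  obtain ⟨v₀⟩ := hT.connected.nonempty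
  have hgate : ∀ g : S, ∃ p, g.1 p = p ∧ ∀ z, g.1 z = z →
      T.dist v₀ p + T.dist p z = T.dist v₀ z := fun g =>
    exists_gate hT v₀ ((hS g g.2 g g.2).imp fun m hm => hm.1)
  choose p hp hpz using hgate
  -- Both gates lie on the geodesic from `v₀` to a common fixed vertex `z`; the farther one is
  -- between `p g` and `z`, hence fixed by `g`.
  have hchain : ∀ g h : S, T.dist v₀ (p g) ≤ T.dist v₀ (p h) →
      g.1 (p h) = p h ∧ T.dist v₀ (p g) + T.dist (p g) (p h) = T.dist v₀ (p h) := by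
    intro g h hle
    obtain ⟨z, hgz, hhz⟩ := hS g g.2 h h.2
    have h1 := hpz g z hgz
    have h2 := hpz h z hhz
    have h3 := hT.dist_add_dist_of_between h1 h2 hle
    exact ⟨fixed_of_between hT (hp g) hgz (by omega), h3⟩
  by_cases hb : BddAbove (Set.range fun g : S => T.dist v₀ (p g))
  · left
    rcases S.eq_empty_or_nonempty with rfl | hne
    · exact ⟨v₀, by simp⟩
    have : Nonempty S := hne.to_subtype
    obtain ⟨h, hh⟩ := Nat.sSup_mem (Set.range_nonempty _) hb
    refine ⟨p h, fun g hg => (hchain ⟨g, hg⟩ h ?_).1⟩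
    have hle := le_csSup hb (Set.mem_range_self (⟨g, hg⟩ : S))
    simp only at hh hle ⊢
    omega
  · right
    have hex : ∀ n : ℕ, ∃ g : S, n ≤ T.dist v₀ (p g) := by
      intro n
      by_contra! hn
      exact hb ⟨n, by rintro _ ⟨g, rfl⟩; exact (hn g).le⟩
    choose γ hγ using hex
    -- `r n` is the vertex at distance `n` from `v₀` on the way to the gate `p (γ n)`.
    choose r hr hr' using fun n => hT.connected.exists_dist_eq_dist_eq v₀ (p (γ n)) (hγ n)
    have hext : ∀ n (g : S), T.dist v₀ (p (γ n)) ≤ T.dist v₀ (p g) →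
        T.dist v₀ (r n) + T.dist (r n) (p g) = T.dist v₀ (p g) := by
      intro n g hle
      have h1 := (hchain _ g hle).2
      have t1 := hT.connected.dist_triangle (u := v₀) (v := r n) (w := p g)
      have t2 := hT.connected.dist_triangle (u := r n) (v := p (γ n)) (w := p g)
      have := hr' n
      omega
    have hray : ∀ i j : ℕ, T.dist (r i) (r (i + j)) = j := by
      intro i j
      obtain ⟨g, hg1, hg2⟩ : ∃ g : S, T.dist v₀ (p (γ i)) ≤ T.dist v₀ (p g) ∧
          T.dist v₀ (p (γ (i + j))) ≤ T.dist v₀ (p g) := by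
        rcases le_total (T.dist v₀ (p (γ i))) (T.dist v₀ (p (γ (i + j)))) with h | h
        · exact ⟨_, h, le_rfl⟩
        · exact ⟨_, le_rfl, h⟩
      have h1 := hr i
      have h2 := hr (i + j)
      have := hT.dist_add_dist_of_between (hext _ g hg1) (hext _ g hg2) (by omega)
      omega
    refine ⟨_, ⟨Set.range r, ⟨r, hray, rfl⟩, rfl⟩, fun g hg => ?_⟩
    -- Beyond the gate of `g`, `r n` lies between `p g` and `p (γ n)`, both fixed by `g`.
    refine mapEnd_eq_of_fixed hT (N := T.dist v₀ (p ⟨g, hg⟩)) fun n hn => ?_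
    have h1 := hr n
    have h2 := hr' n
    obtain ⟨h3, h4⟩ := hchain ⟨g, hg⟩ (γ n) (by omega)
    have h5 := hT.dist_add_dist_of_between h4 h2 (by omega)
    exact fixed_of_between hT (hp ⟨g, hg⟩) h3 (by omega)

theorem fixesVertex_or_invertsEdge_or_fixesEnd (hT : T.IsTree) {S : Subsemigroup (T ≃g T)}
    (hS : ∀ g ∈ S, IsElliptic g) :
    FixesVertex (S : Set (T ≃g T)) ∨ InvertsEdge (S : Set (T ≃g T)) ∨
      FixesEnd (S : Set (T ≃g T)) := by
  by_cases hinv : ∃ g ∈ S, ∃ a b, T.Adj a b ∧ g a = b ∧ g b = a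
  · obtain ⟨g, hg, a, b, hab, ha, hb⟩ := hinv
    exact Or.inr (Or.inl (invertsEdge_of_mem hT hS hg hab ha hb))
  · have hfix : ∀ g ∈ S, ∃ v, g v = v := fun g hg =>
      (hS g hg).resolve_right fun h => hinv ⟨g, hg, h⟩
    have := fixesVertex_or_fixesEnd hT (S := (S : Set (T ≃g T))) fun g hg h hh => by
      obtain ⟨v, hv⟩ := hfix g hg
      obtain ⟨w, hw⟩ := hfix h hh
      obtain ⟨x, hx⟩ := hfix _ (S.mul_mem hg hh)
      exact exists_common_fixed hT hv hw hx
    exact this.imp_right Or.inr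

end TreeAut

/-! ### Locally finite trees: inverses and compactness -/

namespace TreeAut

open SimpleGraph Filter Topology

variable {V : Type*} {T : SimpleGraph V}

theorem tendsto_nhds_iff_eventually_apply_eq {ι : Type*} {l : Filter ι} {f : ι → (T ≃g T)}
    {g : T ≃g T} : Tendsto f l (𝓝 g) ↔ ∀ v, ∀ᶠ i in l, f i v = g v := by
  let _ : TopologicalSpace V := ⊥
  have : DiscreteTopology V := ⟨rfl⟩
  have hind : IsInducing fun g : T ≃g T => (g : V → V) := ⟨rfl⟩
  rw [hind.tendsto_nhds_iff, tendsto_pi_nhds]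
  simp only [nhds_discrete, tendsto_pure, Function.comp_apply]

theorem finite_setOf_dist_le (hT : T.Connected) (hfin : ∀ v, (T.neighborSet v).Finite) (v : V)
    (n : ℕ) : {u | T.dist u v ≤ n}.Finite := by
  induction n with
  | zero =>
    refine (Set.finite_singleton v).subset fun u hu => ?_
    exact hT.dist_eq_zero_iff.mp (Nat.le_zero.mp hu)
  | succ n ih =>
    refine (ih.union (ih.biUnion fun w _ => hfin w)).subset fun u hu => ?_
    by_cases huv : u = v
    · subst huv
      exact Or.inl (by simp)
    · obtain ⟨w, hw, hd⟩ := hT.exists_adj_dist_add_one huv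
      change T.dist u v ≤ n + 1 at hu
      exact Or.inr (Set.mem_biUnion (show T.dist w v ≤ n by omega) hw.symm)

theorem finite_setOf_apply_of_bounded (hT : T.Connected)
    (hfin : ∀ v, (T.neighborSet v).Finite) {v₀ : V} {n : ℕ} (v : V) :
    {u | ∃ g : T ≃g T, T.dist (g v₀) v₀ ≤ n ∧ g v = u}.Finite := by
  refine (finite_setOf_dist_le hT hfin v₀ (T.dist v v₀ + n)).subset ?_
  rintro _ ⟨g, hg, rfl⟩
  have h1 := hT.dist_triangle (u := g v) (v := g v₀) (w := v₀)
  have h2 := dist_iso_apply g v v₀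
  change T.dist (g v) v₀ ≤ _
  omega

theorem dist_symm_apply_self (g : T ≃g T) (v : V) : T.dist (g.symm v) v = T.dist (g v) v := by
  have := dist_iso_apply g (g.symm v) v
  rw [RelIso.apply_symm_apply, dist_comm] at this
  exact this.symm

theorem exists_eventually_apply_eq {α β : Type*} (f : Ultrafilter α) (φ : α → β) {s : Set β}
    (hs : s.Finite) (h : ∀ᶠ a in f, φ a ∈ s) : ∃ b, ∀ᶠ a in f, φ a = b := by
  obtain ⟨b, -, hb⟩ := (Ultrafilter.eventually_exists_mem_iff (f := f) (P := fun b a => φ a = b)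
    hs).mp (h.mono fun a ha => ⟨_, ha, rfl⟩)
  exact ⟨b, hb⟩

/-- In a locally finite tree, a closed set of automorphisms displacing some vertex by a bounded
amount is compact. -/
theorem isCompact_of_bounded (hT : T.Connected) (hfin : ∀ v, (T.neighborSet v).Finite)
    {S : Set (T ≃g T)} (hS : IsClosed S) {v₀ : V} {n : ℕ}
    (hb : ∀ g ∈ S, T.dist (g v₀) v₀ ≤ n) : IsCompact S := by
  rw [isCompact_iff_ultrafilter_le_nhds]
  intro f hf
  have hfS : ∀ᶠ g in (f : Filter (T ≃g T)), g ∈ S := le_principal_iff.mp hf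
  have h1 : ∀ v, ∃ u, ∀ᶠ g : T ≃g T in f, g v = u := fun v =>
    exists_eventually_apply_eq f _ (finite_setOf_apply_of_bounded hT hfin (v₀ := v₀) (n := n) v)
      (hfS.mono fun g hg => ⟨g, hb g hg, rfl⟩)
  -- Inverses must converge too, or the pointwise limit might fail to be surjective.
  have h2 : ∀ v, ∃ u, ∀ᶠ g : T ≃g T in f, g.symm v = u := fun v =>
    exists_eventually_apply_eq f _ (finite_setOf_apply_of_bounded hT hfin (v₀ := v₀) (n := n) v)
      (hfS.mono fun g hg => ⟨g.symm, (dist_symm_apply_self g v₀).trans_le (hb g hg), rfl⟩)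
  choose φ hφ using h1
  choose ψ hψ using h2
  let e : T ≃g T :=
    { toFun := φ
      invFun := ψ
      left_inv := fun v => by
        obtain ⟨g, hg, hg'⟩ := ((hφ v).and (hψ (φ v))).exists
        rw [← hg', ← hg, RelIso.symm_apply_apply]
      right_inv := fun v => by
        obtain ⟨g, hg, hg'⟩ := ((hψ v).and (hφ (ψ v))).exists
        rw [← hg', ← hg, RelIso.apply_symm_apply]
      map_rel_iff' := fun {u v} => by
        obtain ⟨g, hg, hg'⟩ := ((hφ u).and (hφ v)).exists
        change T.Adj (φ u) (φ v) ↔ T.Adj u v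
        rw [← hg, ← hg']
        exact g.map_adj_iff }
  have hlim : Tendsto id (f : Filter (T ≃g T)) (𝓝 e) :=
    tendsto_nhds_iff_eventually_apply_eq.mpr hφ
  exact ⟨e, hS.mem_of_tendsto hlim hfS, hlim⟩

theorem IsElliptic.exists_dist_pow_apply_le {g : T ≃g T} (hg : IsElliptic g) :
    ∃ v, ∀ n : ℕ, T.dist ((g ^ n) v) v ≤ 1 := by
  rcases hg with ⟨v, hv⟩ | ⟨v, w, hvw, hv, hw⟩
  · refine ⟨v, fun n => ?_⟩
    have : (g ^ n) v = v := by
      induction n with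
      | zero => rfl
      | succ n ih =>
        rw [pow_succ]
        change (g ^ n) (g v) = v
        rw [hv, ih]
    rw [this, SimpleGraph.dist_self]
    exact zero_le_one
  · refine ⟨v, fun n => ?_⟩
    have : ((g ^ n) v = v ∨ (g ^ n) v = w) := by
      induction n with
      | zero => exact Or.inl rfl
      | succ n ih =>
        rw [pow_succ']
        change g ((g ^ n) v) = v ∨ g ((g ^ n) v) = w
        rcases ih with h | h <;> simp [h, hv, hw]
    rcases this with h | h
    · rw [h, SimpleGraph.dist_self]
      exact zero_le_one
    · rw [h, dist_eq_one_iff_adj.mpr hvw.symm]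

/-- All powers displace one vertex by at most 1, so the orbit of `v` is finite and the pigeonhole
principle applies. -/
theorem IsElliptic.exists_pow_apply_eq (hT : T.Connected) (hfin : ∀ v, (T.neighborSet v).Finite)
    {g : T ≃g T} (hg : IsElliptic g) (v : V) : ∃ m, 0 < m ∧ (g ^ m) v = v := by
  obtain ⟨v₀, hv₀⟩ := hg.exists_dist_pow_apply_le
  obtain ⟨i, -, j, -, hij, h⟩ := Set.infinite_univ.exists_lt_map_eq_of_mapsTo
    (f := fun n : ℕ => (g ^ n) v)
    (t := {u | ∃ h : T ≃g T, T.dist (h v₀) v₀ ≤ 1 ∧ h v = u}) (fun n _ => ⟨g ^ n, hv₀ n, rfl⟩)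
    (finite_setOf_apply_of_bounded hT hfin v)
  refine ⟨j - i, by omega, (g ^ i).injective ?_⟩
  change (g ^ i * g ^ (j - i)) v = (g ^ i) v
  rw [← pow_add, Nat.add_sub_cancel' hij.le]
  exact h.symm

theorem pow_apply_eq_of_dvd {g : T ≃g T} {v : V} {m n : ℕ} (h : (g ^ m) v = v) (hmn : m ∣ n) :
    (g ^ n) v = v := by
  obtain ⟨k, rfl⟩ := hmn
  induction k with
  | zero => rfl
  | succ k ih =>
    rw [Nat.mul_succ, pow_add]
    change (g ^ (m * k)) ((g ^ m) v) = v
    rw [h, ih]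

/-- The inverse of an elliptic automorphism of a locally finite tree is a limit of positive
powers. -/
theorem IsElliptic.tendsto_pow_inv (hT : T.Connected) (hfin : ∀ v, (T.neighborSet v).Finite)
    {g : T ≃g T} (hg : IsElliptic g) :
    Tendsto (fun n : ℕ => g ^ (n.factorial - 1)) atTop (𝓝 g⁻¹) := by
  rw [tendsto_nhds_iff_eventually_apply_eq]
  intro v
  obtain ⟨m, hm, hmv⟩ := hg.exists_pow_apply_eq hT hfin v
  filter_upwards [eventually_ge_atTop m] with n hn
  have h1 := pow_apply_eq_of_dvd hmv (Nat.dvd_factorial hm hn)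
  have h2 : g ^ (n.factorial - 1) = g⁻¹ * g ^ n.factorial := by
    rw [eq_inv_mul_iff_mul_eq, ← pow_succ', Nat.sub_add_cancel n.factorial_pos]
  rw [h2]
  change g⁻¹ ((g ^ n.factorial) v) = g⁻¹ v
  rw [h1]

theorem inv_mem_of_isClosed (hT : T.Connected) (hfin : ∀ v, (T.neighborSet v).Finite)
    {S : Subsemigroup (T ≃g T)} (hS : IsClosed (S : Set (T ≃g T))) {g : T ≃g T} (hg : g ∈ S)
    (hell : IsElliptic g) : g⁻¹ ∈ S := by
  have hpow : ∀ n : ℕ, g ^ (n + 1) ∈ S := by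
    intro n
    induction n with
    | zero => simpa using hg
    | succ n ih =>
      rw [pow_succ]
      exact S.mul_mem ih hg
  refine hS.mem_of_tendsto (hell.tendsto_pow_inv hT hfin) ?_
  -- For `n ≥ 2` the exponent `n! - 1` is positive; the identity is not yet known to be in `S`.
  filter_upwards [eventually_ge_atTop 2] with n hn
  have := Nat.factorial_le hn
  have h2 := hpow (n.factorial - 2)
  rwa [show n.factorial - 2 + 1 = n.factorial - 1 by simp at this; omega] at h2

theorem exists_bounded_of_not_fixesEnd {S : Set (T ≃g T)}
    (h : FixesVertex S ∨ InvertsEdge S ∨ FixesEnd S) (hend : ¬ FixesEnd S) :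
    ∃ v, ∀ g ∈ S, T.dist (g v) v ≤ 1 := by
  rcases h with ⟨v, hv⟩ | ⟨v, w, hvw, hS, -⟩ | h
  · exact ⟨v, fun g hg => by rw [hv g hg, SimpleGraph.dist_self]; exact zero_le_one⟩
  · refine ⟨v, fun g hg => ?_⟩
    rcases hS g hg with h | h
    · rw [h.1, SimpleGraph.dist_self]
      exact zero_le_one
    · rw [h.1, dist_eq_one_iff_adj.mpr hvw.symm]
  · exact absurd h hend

end TreeAut

theorem mainTheorem8 {V : Type*} (T : SimpleGraph V) (hT : T.IsTree)
    (S : Subsemigroup (T ≃g T)) (hS : ∀ g ∈ S, TreeAut.IsElliptic g) :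
    (TreeAut.FixesVertex (S : Set (T ≃g T)) ∨ TreeAut.InvertsEdge (S : Set (T ≃g T)) ∨
      TreeAut.FixesEnd (S : Set (T ≃g T))) ∧
    ((∀ v, (T.neighborSet v).Finite) → (S : Set (T ≃g T)).Nonempty →
      IsClosed (S : Set (T ≃g T)) →
      ∃ H : Subgroup (T ≃g T), (H : Set (T ≃g T)) = (S : Set (T ≃g T)) ∧
        (¬ TreeAut.FixesEnd (H : Set (T ≃g T)) → IsCompact (H : Set (T ≃g T)))) := by
  have h1 := TreeAut.fixesVertex_or_invertsEdge_or_fixesEnd hT hS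
  refine ⟨h1, fun hfin hne hcl => ?_⟩
  have hinv : ∀ g ∈ S, g⁻¹ ∈ S := fun g hg =>
    TreeAut.inv_mem_of_isClosed hT.connected hfin hcl hg (hS g hg)
  obtain ⟨g, hg⟩ := hne
  refine ⟨{ carrier := S
            mul_mem' := S.mul_mem
            one_mem' := by
              rw [← mul_inv_cancel g]
              exact S.mul_mem hg (hinv g hg)
            inv_mem' := fun {g} hg => hinv g hg }, rfl, fun hend => ?_⟩
  obtain ⟨v, hv⟩ := TreeAut.exists_bounded_of_not_fixesEnd h1 hend
  exact TreeAut.isCompact_of_bounded hT.connected hfin hcl hv
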